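/- Let $R$ and $S$ be two-sided Noetherian rings (with unit, not necessarily commutative) and let $l\colon R\to S$ be a unital ring homomorphism. For a ring $A$ let $A$-mod be the category of finitely generated left $A$-modules, and for a module $X$ let $\mathrm{add}\,X$ be the class of all modules isomorphic to a direct summand of a finite direct sum of copies of $X$. Assume that (a) $S/R$ is a Frobenius extension, i.e. ${}_RS$ is finitely generated projective and ${}_SS_R\cong\mathrm{Hom}_R({}_RS_S,{}_RR_R)$ as $S$-$R$-bimodules; (b) ${}_RS_R$ is centrally projective over $R$, i.e. ${}_RS_R$ is isomorphic, as an $R$-$R$-bimodule, to a direct summand of ${}_RR_R^{\,k}$ for some $k\ge 0$. Let $n\ge 1$ be an integer and let $\omega$ be a finitely generated left $R$-module such that (c) $\mathrm{fadim}_R\,\omega\ge n+2$, i.e. there is an exact sequence $0\to R\xrightarrow{f_1}\omega_1\xrightarrow{f_2}\cdots\xrightarrow{f_{n+2}}\omega_{n+2}$ of left $R$-modules with all $\omega_i\in\mathrm{add}\,\omega$ such that, for $1\le i\le n+2$, the inclusion $\mathrm{Im}\,f_i\to\omega_i$ is a left $\mathrm{add}\,\omega$-approximation, i.e. $\mathrm{Hom}_R(\omega_i,X)\to\mathrm{Hom}_R(\mathrm{Im}\,f_i,X)$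 is surjective for every $X\in\mathrm{add}\,\omega$; (d) $\mathrm{Ext}^i_R(\omega,\omega)=0$ for $1\le i\le n$. For a ring $A$ (here $A=R$ or $A=S$), a left $A$-module $V$ and $M\in A$-mod, put $T=\mathrm{End}_A(V)$, acting on $V$ from the right, choose a presentation $P_1\xrightarrow{f}P_0\to M\to 0$ by finitely generated projective left $A$-modules, and let $\mathrm{Tr}_VM$ be the cokernel of $\mathrm{Hom}_A(f,V)\colon\mathrm{Hom}_A(P_0,V)\to\mathrm{Hom}_A(P_1,V)$, a right $T$-module. Call $M$ $V$-$n$-torsionfree if $\mathrm{Ext}^i_{T^{\mathrm{op}}}(\mathrm{Tr}_VM,V)=0$ (Ext of right $T$-modules) for $1\le i\le n$ for some such presentation, and let $\mathcal T^n_V(A)$ be the class of $V$-$n$-torsionfree modules in $A$-mod. A class $\mathcal X$ of modules is extension-closed if for every short exact sequence $0\to X'\to X\to X''\to 0$ with $X',X''\in\mathcal X$ also $X\in\mathcal X$. If $\mathcal T^n_\omega(R)$ is extension-closed, then $\mathcal T^n_{S\otimes_R\omega}(S)$ is extension-closed. -/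

import Mathlib

open CategoryTheory TensorProduct
open scoped MulOpposite

universe u

namespace RelTorsionfree

section Modules

variable {R : Type u} [Ring R]

/-- `X ∈ add M`: the left `R`-module `X` is isomorphic to a direct summand of a finite direct sum
of copies of `M`. -/
def MemAdd (M : Type u) [AddCommGroup M] [Module R M] (X : Type u) [AddCommGroup X] [Module R X] :
    Prop :=
  ∃ (k : ℕ) (ι : X →ₗ[R] (Fin k → M)) (π : (Fin k → M) →ₗ[R] X), π ∘ₗ ι = LinearMap.id

/-- `g : N → C` is a left `add M`-approximation of `N`: `C ∈ add M`, and for every `X ∈ add M`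
the map `Hom_R(C, X) → Hom_R(N, X)`, `h' ↦ h' ∘ g`, is surjective. -/
def IsLeftAddApprox (M : Type u) [AddCommGroup M] [Module R M]
    {N C : Type u} [AddCommGroup N] [Module R N] [AddCommGroup C] [Module R C]
    (g : N →ₗ[R] C) : Prop :=
  MemAdd (R := R) M C ∧
    ∀ (X : Type u) [AddCommGroup X] [Module R X], MemAdd (R := R) M X →
      ∀ h : N →ₗ[R] X, ∃ h' : C →ₗ[R] X, h' ∘ₗ g = h

variable (R) in
/-- `fadim_R M ≥ n`: there is an exact sequence `0 → X₀ → X₁ → ⋯ → Xₙ` with `X₀ ≅ R` such that the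
inclusion of the image of `X_{i-1} → X_i` into `X_i` is a left `add M`-approximation for
`1 ≤ i ≤ n`. (The map called `f_i` in the usual indexing is `f (i - 1)` here; the modules and maps
beyond the index `n` play no role.) -/
def FaithfulDimGE (M : Type u) [AddCommGroup M] [Module R M] (n : ℕ) : Prop :=
  ∃ (X : ℕ → ModuleCat.{u} R) (f : ∀ i, X i →ₗ[R] X (i + 1)),
    Nonempty (X 0 ≃ₗ[R] R) ∧
    (0 < n → Function.Injective (f 0)) ∧
    (∀ i, i + 1 < n → Function.Exact (f i) (f (i + 1))) ∧
    ∀ i, i < n → IsLeftAddApprox (R := R) M (LinearMap.range (f i)).subtype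

/-- For `f : P₁ → P₀`, the map `f^ω : Hom_R(P₀, ω) → Hom_R(P₁, ω)`, `g ↦ g ∘ f`. Both sides are
modules over `Module.End R ω` by composition; a left module over `Module.End R ω` (whose product is
composition of maps) is the same thing as a right module over `T = End_R(ω)` when, as is customary
for left modules `ω`, endomorphisms are written on the right. -/
def dualMap (ω : Type u) [AddCommGroup ω] [Module R ω]
    {P₁ P₀ : Type u} [AddCommGroup P₁] [Module R P₁] [AddCommGroup P₀] [Module R P₀]
    (f : P₁ →ₗ[R] P₀) : (P₀ →ₗ[R] ω) →ₗ[Module.End R ω] (P₁ →ₗ[R] ω) where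
  toFun g := g ∘ₗ f
  map_add' _ _ := rfl
  map_smul' _ _ := rfl

/-- The cokernel of `f^ω`. If `P₁ → P₀ → M → 0` is a projective presentation of `M`, this is the
transpose `Tr_ω M` of `M` relative to `ω`. -/
abbrev Transpose (ω : Type u) [AddCommGroup ω] [Module R ω]
    {P₁ P₀ : Type u} [AddCommGroup P₁] [Module R P₁] [AddCommGroup P₀] [Module R P₀]
    (f : P₁ →ₗ[R] P₀) : Type u :=
  (P₁ →ₗ[R] ω) ⧸ LinearMap.range (dualMap ω f)

variable (R) in
/-- `T^n_ω(R)`: the class of finitely generated left `R`-modules `M` that are `ω`-`n`-torsionfree,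
i.e. `Ext^i(Tr_ω M, ω) = 0` over `T = End_R(ω)` for `1 ≤ i ≤ n`, where `Tr_ω M` is formed from a
presentation `P₁ → P₀ → M → 0` by finitely generated projective modules. -/
def torsionfreeClass (ω : Type u) [AddCommGroup ω] [Module R ω] (n : ℕ) :
    ObjectProperty (ModuleCat.{u} R) := fun M =>
  Module.Finite R M ∧
    ∃ (P₁ P₀ : ModuleCat.{u} R) (f : P₁ →ₗ[R] P₀) (p : P₀ →ₗ[R] M),
      Module.Finite R P₁ ∧ Module.Projective R P₁ ∧
      Module.Finite R P₀ ∧ Module.Projective R P₀ ∧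
      Function.Exact f p ∧ Function.Surjective p ∧
      ∀ i : ℕ, 1 ≤ i → i ≤ n →
        Subsingleton (Abelian.Ext.{u}
          (ModuleCat.of (Module.End R ω) (Transpose ω f))
          (ModuleCat.of (Module.End R ω) ω) i)

end Modules

section Extension

variable {R S : Type u} [Ring R] [Ring S]

/-- The ring extension `l : R → S` is a Frobenius extension: `S` is finitely generated projective as
a left `R`-module, and `S ≅ Hom_R(S, R)` as `S`-`R`-bimodules, where `Hom_R(S, R)` (left `R`-linear
maps) carries the actions `(s • φ)(x) = φ(x s)` and `(φ • r)(x) = φ(x) r`. -/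
def IsFrobeniusExtension (l : R →+* S) : Prop :=
  letI : Module R S := Module.compHom S l
  Module.Finite R S ∧ Module.Projective R S ∧
    ∃ e : S ≃+ (S →ₗ[R] R),
      (∀ s t x : S, e (s * t) x = e t (x * s)) ∧
      (∀ (t : S) (r : R) (x : S), e (t * l r) x = e t x * r)

/-- `_R S_R` is centrally projective over `R`: as an `R`-`R`-bimodule, `S` is isomorphic to a direct
summand of `R ^ k` for some `k`. -/
def IsCentrallyProjective (l : R →+* S) : Prop :=
  ∃ (k : ℕ) (ι : S →+ (Fin k → R)) (π : (Fin k → R) →+ S),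
    (∀ (r : R) (s : S) (j : Fin k), ι (l r * s) j = r * ι s j) ∧
    (∀ (s : S) (r : R) (j : Fin k), ι (s * l r) j = ι s j * r) ∧
    (∀ (r : R) (v : Fin k → R), π (fun j => r * v j) = l r * π v) ∧
    (∀ (v : Fin k → R) (r : R), π (fun j => v j * r) = π v * l r) ∧
    ∀ s : S, π (ι s) = s

/-- The relations `(s · l(r)) ⊗ m = s ⊗ (r • m)` of the tensor product over `R`, as an `S`-submodule
of `S ⊗_ℤ M`. -/
def tensorRel (l : R →+* S) (M : Type u) [AddCommGroup M] [Module R M] :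
    Submodule S (S ⊗[ℤ] M) :=
  Submodule.span S {z | ∃ (s : S) (r : R) (m : M), z = (s * l r) ⊗ₜ[ℤ] m - s ⊗ₜ[ℤ] (r • m)}

/-- The left `S`-module `S ⊗_R M` for a ring extension `l : R → S` of possibly noncommutative rings
and a left `R`-module `M`. -/
abbrev ExtendScalars (l : R →+* S) (M : Type u) [AddCommGroup M] [Module R M] : Type u :=
  (S ⊗[ℤ] M) ⧸ tensorRel l M

end Extension

end RelTorsionfree

/-!
Write `W = S ⊗_R ω`. The theorem holds because an `S`-module `M` is `W`-`n`-torsionfree over `S` if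
and only if its restriction to `R` is `ω`-`n`-torsionfree over `R`
(`torsionfreeClass_restrictScalars_iff`): restriction of scalars is exact, so closure under
extensions passes from `R` to `S`.

The equivalence rests on three facts.

* Since `S/R` is a Frobenius extension, `W` is not only induced but also coinduced from `ω`, that
  is, `Hom_S(M, W) ≅ Hom_R(M, ω)` naturally in the `S`-module `M` (`exists_isCoinduced`). So the
  transpose relative to `W` of a presentation over `S` is, as a module over `T = End_R(ω)`, the
  transpose relative to `ω` of the restricted presentation, which is again projective because `S`
  is projective over `R`.
* Since `S` is centrally projective, `W` lies in `add ω` over `R` (`memAdd_extendScalars`). Hence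
  `End_S(W) ≅ Hom_R(W, ω)` is projective over `T`, and `W ≅ Hom_T(End_S(W), ω)` is coinduced from
  the `T`-module `ω`. By the Eckmann–Shapiro lemma, the vanishing of Ext into `W` over `End_S(W)`
  is the same as the vanishing of Ext into `ω` over `T` (`IsCoinduced.extVanish_transpose_iff`).
* Since `fadim ω ≥ n + 2`, one has `Ext^i_T(ω, ω) = 0` for `1 ≤ i ≤ n`
  (`FaithfulDimGE.extVanish`), and this makes relative `n`-torsionfreeness independent of the
  chosen presentation (`ExtVanish.transpose_of_presentation`). A presentation over `R` may thus be
  replaced by the restriction of one over `S`.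
-/

namespace RelTorsionfree

/-! ### Vanishing of Ext groups -/

section ExtVanishing

variable {T : Type u} [Ring T]

/-- `Ext^i(X, Z) = 0`, for unbundled modules. -/
abbrev ExtVanish (T : Type u) [Ring T] (X Z : Type u) [AddCommGroup X] [Module T X]
    [AddCommGroup Z] [Module T Z] (i : ℕ) : Prop :=
  Subsingleton (Abelian.Ext.{u} (ModuleCat.of T X) (ModuleCat.of T Z) i)

/-- If the identity of `X` is a sum of maps that factor through modules `Y j`, then `Ext^i(X, Z)`
vanishes as soon as all `Ext^i(Y j, Z)` do. -/
lemma ExtVanish.of_sum_comp_eq_id {ι : Type} [Fintype ι] {X Z : Type u}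
    [AddCommGroup X] [Module T X] [AddCommGroup Z] [Module T Z] (Y : ι → ModuleCat.{u} T)
    (a : ∀ j, X →ₗ[T] Y j) (b : ∀ j, Y j →ₗ[T] X) (hab : ∀ x, ∑ j, b j (a j x) = x)
    {i : ℕ} (hY : ∀ j, ExtVanish T (Y j) Z i) : ExtVanish T X Z i := by
  refine subsingleton_of_forall_eq 0 fun e => ?_
  have hid : 𝟙 (ModuleCat.of T X) = ∑ j, ModuleCat.ofHom (a j) ≫ ModuleCat.ofHom (b j) := by
    ext x
    rw [ModuleCat.hom_sum]
    simp [LinearMap.sum_apply, hab]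
  rw [← Abelian.Ext.mk₀_id_comp e, hid, Abelian.Ext.mk₀_sum, Abelian.Ext.sum_comp]
  refine Finset.sum_eq_zero fun j _ => ?_
  rw [← Abelian.Ext.mk₀_comp_mk₀_assoc,
    (hY j).elim ((Abelian.Ext.mk₀ (ModuleCat.ofHom (b j))).comp e (zero_add i)) 0,
    Abelian.Ext.comp_zero]

lemma ExtVanish.of_linearEquiv {X Y Z : Type u} [AddCommGroup X] [Module T X]
    [AddCommGroup Y] [Module T Y] [AddCommGroup Z] [Module T Z] (e : X ≃ₗ[T] Y) {i : ℕ}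
    (hY : ExtVanish T Y Z i) : ExtVanish T X Z i :=
  .of_sum_comp_eq_id (ι := Unit) (fun _ => ModuleCat.of T Y) (fun _ => e.toLinearMap)
    (fun _ => e.symm.toLinearMap) (fun x => by simp) fun _ => hY

variable {K P Y : Type u} [AddCommGroup K] [Module T K] [AddCommGroup P] [Module T P]
  [AddCommGroup Y] [Module T Y] {k : K →ₗ[T] P} {q : P →ₗ[T] Y}

lemma shortExact_of_function (hk : Function.Injective k) (hkq : Function.Exact k q)
    (hq : Function.Surjective q) :
    (ShortComplex.mk (ModuleCat.ofHom k) (ModuleCat.ofHom q)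
      (ModuleCat.hom_ext hkq.linearMap_comp_eq_zero)).ShortExact where
  exact := (ShortComplex.ShortExact.moduleCat_exact_iff_function_exact _).2 hkq
  mono_f := (ModuleCat.mono_iff_injective _).2 hk
  epi_g := (ModuleCat.epi_iff_surjective _).2 hq

/-- Dimension shifting along `0 → K → P → Y → 0` with `P` projective, in degrees at least `2`. -/
lemma extVanish_succ_succ_iff [Module.Projective T P] (hk : Function.Injective k)
    (hkq : Function.Exact k q) (hq : Function.Surjective q)
    (Z : Type u) [AddCommGroup Z] [Module T Z] (i : ℕ) :
    ExtVanish T Y Z (i + 2) ↔ ExtVanish T K Z (i + 1) := by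
  have hS := shortExact_of_function hk hkq hq
  have hP : CategoryTheory.Projective (ModuleCat.of T P) :=
    (IsProjective.iff_projective P).1 inferInstance
  constructor <;> intro h <;> refine subsingleton_of_forall_eq 0 fun e => ?_
  · obtain ⟨x, rfl⟩ := Abelian.Ext.contravariant_sequence_exact₁ hS _ e
      (n₁ := i + 2) (by lia) (h.elim _ _)
    rw [Abelian.Ext.eq_zero_of_projective x, Abelian.Ext.comp_zero]
  · obtain ⟨x, rfl⟩ := Abelian.Ext.contravariant_sequence_exact₃ hS _ e
      (n₀ := i + 1) (Abelian.Ext.eq_zero_of_projective _) (by lia)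
    rw [h.elim x 0, Abelian.Ext.comp_zero]

/-- Dimension shifting along `0 → K → P → Y → 0` with `P` projective, in degree `1`. -/
lemma extVanish_one_iff [Module.Projective T P] (hk : Function.Injective k)
    (hkq : Function.Exact k q) (hq : Function.Surjective q)
    (Z : Type u) [AddCommGroup Z] [Module T Z] :
    ExtVanish T Y Z 1 ↔ ∀ g : K →ₗ[T] Z, ∃ g' : P →ₗ[T] Z, g' ∘ₗ k = g := by
  have hS := shortExact_of_function hk hkq hq
  have hP : CategoryTheory.Projective (ModuleCat.of T P) :=
    (IsProjective.iff_projective P).1 inferInstance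
  constructor
  · intro h g
    obtain ⟨x, hx⟩ := Abelian.Ext.contravariant_sequence_exact₁ hS (ModuleCat.of T Z)
      (Abelian.Ext.mk₀ (ModuleCat.ofHom g)) (n₁ := 1) (by lia) (h.elim _ _)
    obtain ⟨y, rfl⟩ := (Abelian.Ext.mk₀_bijective _ _).2 x
    rw [Abelian.Ext.mk₀_comp_mk₀] at hx
    exact ⟨y.hom, congrArg ModuleCat.Hom.hom ((Abelian.Ext.mk₀_bijective _ _).1 hx)⟩
  · intro h
    refine subsingleton_of_forall_eq 0 fun e => ?_
    obtain ⟨x, rfl⟩ := Abelian.Ext.contravariant_sequence_exact₃ hS _ e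
      (n₀ := 0) (Abelian.Ext.eq_zero_of_projective _) (by lia)
    obtain ⟨y, rfl⟩ := (Abelian.Ext.mk₀_bijective _ _).2 x
    obtain ⟨g, hg⟩ := h y.hom
    have hy : y = ModuleCat.ofHom k ≫ ModuleCat.ofHom g := ModuleCat.hom_ext hg.symm
    rw [hy, ← Abelian.Ext.mk₀_comp_mk₀, ShortComplex.ShortExact.extClass_comp_assoc]

/-- The `B`-module `W`, with the `A`-linear map `ε : W → V`, is coinduced from the `A`-module `V`
along `A → B`: every `A`-linear map from a `B`-module to `V` factors uniquely through `ε` by a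
`B`-linear map, that is, `W ≅ Hom_A(B, V)` with `ε` the evaluation at `1`. The ring homomorphism
`A → B` is encoded by the `A`-module structure of `B` and the scalar towers. -/
def IsCoinduced (A B : Type u) [Ring A] [Ring B] [Module A B]
    {W V : Type u} [AddCommGroup W] [Module B W] [AddCommGroup V] [Module A V]
    [Module A W] [IsScalarTower A B W] (ε : W →ₗ[A] V) : Prop :=
  ∀ (X : Type u) [AddCommGroup X] [Module B X] [Module A X] [IsScalarTower A B X]
    (g : X →ₗ[A] V), ∃! h : X →ₗ[B] W, ε ∘ₗ h.restrictScalars A = g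

/-- Every `B`-module is a quotient of a `B`-module that is projective over `B` and over `A`. -/
lemma exists_projective_surjection (A : Type u) {B : Type u} [Ring A] [Ring B] [Module A B]
    [IsScalarTower A B B] [Module.Projective A B] (X : Type u) [AddCommGroup X] [Module B X] :
    ∃ (F : Type u) (_ : AddCommGroup F) (_ : Module B F) (_ : Module A F)
      (_ : IsScalarTower A B F) (_ : Module.Projective B F) (_ : Module.Projective A F)
      (q : F →ₗ[B] X), Function.Surjective q := by
  classical
  have : Module.Projective A (X →₀ B) := .of_equiv (finsuppLequivDFinsupp (M := B) A).symm
  exact ⟨X →₀ B, inferInstance, inferInstance, inferInstance, inferInstance, inferInstance, this,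
    Finsupp.linearCombination B id, Finsupp.linearCombination_id_surjective B X⟩

/-- Eckmann–Shapiro in the form needed here: if `W` is coinduced from `V` along `A → B`, and `B`
is projective over `A`, then `Ext_B(X, W)` and `Ext_A(X, V)` vanish in the same positive degrees. -/
lemma extVanish_change_of_rings {A B : Type u} [Ring A] [Ring B] [Module A B]
    [IsScalarTower A B B] [Module.Projective A B]
    {W V : Type u} [AddCommGroup W] [Module B W] [AddCommGroup V] [Module A V]
    [Module A W] [IsScalarTower A B W] {ε : W →ₗ[A] V} (hε : IsCoinduced A B ε)
    (X : Type u) [AddCommGroup X] [Module B X] [Module A X] [IsScalarTower A B X] (i : ℕ) :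
    ExtVanish B X W (i + 1) ↔ ExtVanish A X V (i + 1) := by
  obtain ⟨F, _, _, _, _, _, _, q, hq⟩ := exists_projective_surjection A (B := B) X
  have hk : Function.Injective q.ker.subtype := q.ker.injective_subtype
  have hkq : Function.Exact q.ker.subtype q := LinearMap.exact_subtype_ker_map q
  have hA : Function.Exact (q.ker.subtype.restrictScalars A) (q.restrictScalars A) := hkq
  cases i with
  | succ i =>
    rw [extVanish_succ_succ_iff hk hkq hq,
      extVanish_succ_succ_iff (T := A) hk hA hq]
    exact extVanish_change_of_rings hε _ i
  | zero =>
    rw [zero_add, extVanish_one_iff hk hkq hq,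
      extVanish_one_iff (T := A) hk hA hq]
    constructor
    · intro H g
      obtain ⟨h, rfl, -⟩ := hε _ g
      obtain ⟨h', rfl⟩ := H h
      exact ⟨ε ∘ₗ h'.restrictScalars A, rfl⟩
    · intro H h
      obtain ⟨g, hg⟩ := H (ε ∘ₗ h.restrictScalars A)
      obtain ⟨h', rfl, -⟩ := hε _ g
      exact ⟨h', (hε _ (ε ∘ₗ h.restrictScalars A)).unique hg rfl⟩

end ExtVanishing

/-! ### Duals of modules in `add ω` -/

section Dual

variable {R : Type u} [Ring R] {ω : Type u} [AddCommGroup ω] [Module R ω]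
  {X : Type u} [AddCommGroup X] [Module R X]

/-- Membership in `add ω` in terms of the components of the two maps `X → ω ^ k → X`. -/
lemma memAdd_iff : MemAdd (R := R) ω X ↔
    ∃ (k : ℕ) (a : Fin k → X →ₗ[R] ω) (b : Fin k → ω →ₗ[R] X), ∀ x, ∑ j, b j (a j x) = x := by
  constructor
  · rintro ⟨k, ι, π, h⟩
    refine ⟨k, fun j => LinearMap.proj j ∘ₗ ι,
      fun j => π ∘ₗ LinearMap.single R (fun _ => ω) j, fun x => ?_⟩
    have := LinearMap.congr_fun h x
    simp only [LinearMap.comp_apply, LinearMap.proj_apply, LinearMap.id_apply] at this ⊢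
    rw [← map_sum]
    simpa [Finset.univ_sum_single] using this
  · rintro ⟨k, a, b, h⟩
    exact ⟨k, LinearMap.pi a, ∑ j, b j ∘ₗ LinearMap.proj j, LinearMap.ext fun x => by simp [h]⟩

lemma memAdd_self : MemAdd (R := R) ω ω :=
  memAdd_iff.2 ⟨1, fun _ => .id, fun _ => .id, fun x => by simp⟩

lemma memAdd_of_finite_of_projective [Module.Finite R X] [Module.Projective R X] :
    MemAdd (R := R) R X := by
  obtain ⟨k, π, hπ⟩ := Module.Finite.exists_fin' R X
  obtain ⟨ι, hι⟩ := Module.projective_lifting_property π LinearMap.id hπ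
  exact ⟨k, ι, π, hι⟩

lemma MemAdd.eq_of_forall_apply_eq (hX : MemAdd (R := R) ω X) {x y : X}
    (h : ∀ φ : X →ₗ[R] ω, φ x = φ y) : x = y := by
  obtain ⟨k, a, b, hab⟩ := memAdd_iff.1 hX
  rw [← hab x, ← hab y]
  simp only [h]

/-- Modules in `add ω` are reflexive with respect to `ω`: the evaluation
`X → Hom_T(Hom_R(X, ω), ω)`, with `T = End_R(ω)`, is surjective. It is injective by
`MemAdd.eq_of_forall_apply_eq`. -/
lemma MemAdd.exists_eq_eval (hX : MemAdd (R := R) ω X)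
    (Θ : (X →ₗ[R] ω) →ₗ[Module.End R ω] ω) : ∃ x, ∀ φ, Θ φ = φ x := by
  obtain ⟨k, a, b, hab⟩ := memAdd_iff.1 hX
  refine ⟨∑ j, b j (Θ (a j)), fun φ => ?_⟩
  have hφ : φ = ∑ j, (φ ∘ₗ b j : Module.End R ω) • a j := LinearMap.ext fun x => by
    rw [LinearMap.sum_apply]
    change φ x = ∑ j, φ (b j (a j x))
    rw [← map_sum, hab]
  conv_lhs => rw [hφ]
  rw [map_sum, map_sum]
  exact Finset.sum_congr rfl fun j _ => by rw [map_smul]; rfl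

lemma MemAdd.projective_dual (hX : MemAdd (R := R) ω X) :
    Module.Projective (Module.End R ω) (X →ₗ[R] ω) := by
  obtain ⟨k, a, b, hab⟩ := memAdd_iff.1 hX
  have : Module.Projective (Module.End R ω) (ω →ₗ[R] ω) :=
    inferInstanceAs (Module.Projective (Module.End R ω) (Module.End R ω))
  have : Module.Projective (Module.End R ω) (Π₀ _ : Fin k, (ω →ₗ[R] ω)) := inferInstance
  have : Module.Projective (Module.End R ω) (Fin k → (ω →ₗ[R] ω)) :=
    .of_equiv (DFinsupp.linearEquivFunOnFintype (R := Module.End R ω))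
  refine .of_split (LinearMap.pi fun j => dualMap ω (b j))
    (∑ j, dualMap ω (a j) ∘ₗ LinearMap.proj j) (LinearMap.ext fun φ => LinearMap.ext fun x => ?_)
  simp only [LinearMap.comp_apply, LinearMap.sum_apply, LinearMap.proj_apply, LinearMap.pi_apply]
  change ∑ j, φ (b j (a j x)) = φ x
  rw [← map_sum, hab]

lemma MemAdd.extVanish_dual {M : Type u} [AddCommGroup M] [Module R M] (hX : MemAdd (R := R) M X)
    {Z : Type u} [AddCommGroup Z] [Module (Module.End R ω) Z] {i : ℕ}
    (h : ExtVanish (Module.End R ω) (M →ₗ[R] ω) Z i) :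
    ExtVanish (Module.End R ω) (X →ₗ[R] ω) Z i := by
  obtain ⟨k, a, b, hab⟩ := memAdd_iff.1 hX
  refine .of_sum_comp_eq_id (fun _ : Fin k => ModuleCat.of _ (M →ₗ[R] ω))
    (fun j => dualMap ω (b j)) (fun j => dualMap ω (a j)) (fun φ => LinearMap.ext fun x => ?_)
    fun _ => h
  rw [LinearMap.sum_apply]
  change ∑ j, φ (b j (a j x)) = φ x
  rw [← map_sum, hab]

lemma extVanish_dual_of_projective [Module.Finite R X] [Module.Projective R X]
    {Z : Type u} [AddCommGroup Z] [Module (Module.End R ω) Z] {i : ℕ}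
    (h : ExtVanish (Module.End R ω) ω Z i) : ExtVanish (Module.End R ω) (X →ₗ[R] ω) Z i :=
  (memAdd_of_finite_of_projective (R := R)).extVanish_dual
    (h.of_linearEquiv (LinearMap.ringLmapEquivSelf R (Module.End R ω) ω))

end Dual

/-! ### Faithful dimension and self-extensions over the endomorphism ring -/

section FaithfulDimension

variable {R : Type u} [Ring R] {ω : Type u} [AddCommGroup ω] [Module R ω]

/-- A map to `ω` that vanishes on the kernel of `f` extends along `f`, if the inclusion of the image
of `f` is a left `add ω`-approximation. -/
lemma IsLeftAddApprox.exists_extend {N C : Type u} [AddCommGroup N] [Module R N]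
    [AddCommGroup C] [Module R C] {f : N →ₗ[R] C}
    (hf : IsLeftAddApprox (R := R) ω (LinearMap.range f).subtype) (g : N →ₗ[R] ω)
    (hg : LinearMap.ker f ≤ LinearMap.ker g) : ∃ g' : C →ₗ[R] ω, g' ∘ₗ f = g := by
  obtain ⟨g', hg'⟩ := hf.2 ω memAdd_self
    ((LinearMap.ker f).liftQ g hg ∘ₗ f.quotKerEquivRange.symm.toLinearMap)
  refine ⟨g', LinearMap.ext fun x => ?_⟩
  have := LinearMap.congr_fun hg' ⟨f x, x, rfl⟩
  simp only [LinearMap.comp_apply, Submodule.subtype_apply, LinearEquiv.coe_coe] at this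
  rw [LinearMap.comp_apply, this]
  have h2 : f.quotKerEquivRange.symm ⟨f x, x, rfl⟩ = (LinearMap.ker f).mkQ x := by
    rw [LinearEquiv.symm_apply_eq]; rfl
  rw [h2]; rfl

/-- If `fadim ω ≥ n + 2`, then `Ext^i_T(ω, ω) = 0` for `1 ≤ i ≤ n`, where `T = End_R(ω)`. Applying
`Hom_R(-, ω)` to the sequence `0 → R → X₁ → ⋯ → Xₙ₊₂` gives the beginning of a projective resolution
of the `T`-module `ω`, and applying `Hom_T(-, ω)` to that gives back `X₁ → ⋯ → Xₙ₊₂`, which is exact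
at `X₂, …, Xₙ₊₁`. -/
theorem FaithfulDimGE.extVanish {n : ℕ} (h : FaithfulDimGE R ω (n + 2)) {j : ℕ} (hj : j < n) :
    ExtVanish (Module.End R ω) ω ω (j + 1) := by
  obtain ⟨X, f, ⟨e⟩, hinj, hex, happ⟩ := h
  have hexact : ∀ i < n + 1, Function.Exact (dualMap ω (f (i + 1))) (dualMap ω (f i)) := by
    intro i hi g
    constructor
    · intro hg
      refine (happ (i + 1) (by lia)).exists_extend g fun x hx => ?_
      obtain ⟨y, rfl⟩ := (hex i (by lia) x).1 hx
      exact LinearMap.congr_fun hg y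
    · rintro ⟨g, rfl⟩
      refine LinearMap.ext fun x => ?_
      change g (f (i + 1) (f i x)) = 0
      rw [(hex i (by lia)).apply_apply_eq_zero, map_zero]
  have hproj : ∀ i < n + 2, Module.Projective (Module.End R ω) (X (i + 1) →ₗ[R] ω) := fun i hi =>
    (happ i hi).1.projective_dual
  have hses : ∀ i < n + 1, Function.Exact (LinearMap.range (dualMap ω (f (i + 1)))).subtype
      (dualMap ω (f i)).rangeRestrict := fun i hi g => by
    rw [Subtype.ext_iff]
    simpa using hexact i hi g
  have key : ∀ j i, i + j < n →
      ExtVanish (Module.End R ω) (LinearMap.range (dualMap ω (f i))) ω (j + 1) := by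
    intro j
    induction j with
    | succ j ih =>
      intro i hi
      have := hproj i (by lia)
      rw [extVanish_succ_succ_iff (Submodule.injective_subtype _) (hses i (by lia))
        (LinearMap.surjective_rangeRestrict _)]
      exact ih (i + 1) (by lia)
    | zero =>
      intro i hi
      have := hproj i (by lia)
      rw [zero_add, extVanish_one_iff (Submodule.injective_subtype _) (hses i (by lia))
        (LinearMap.surjective_rangeRestrict _)]
      intro g
      -- Pulled back to `Hom(X (i + 2), ω)`, the map `g` is the evaluation at some `x`, and `x`
      -- comes from `y : X (i + 1)`; the evaluation at `y` extends `g`.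
      obtain ⟨x, hx⟩ := (happ (i + 1) (by lia)).1.exists_eq_eval
        (g ∘ₗ (dualMap ω (f (i + 1))).rangeRestrict)
      have hfx : f (i + 2) x = 0 :=
        (happ (i + 2) (by lia)).1.eq_of_forall_apply_eq fun φ => by
          have h0 : (dualMap ω (f (i + 1))).rangeRestrict (φ ∘ₗ f (i + 2)) = 0 :=
            Subtype.ext ((hexact (i + 1) (by lia)).apply_apply_eq_zero φ)
          rw [map_zero, ← LinearMap.comp_apply, ← hx, LinearMap.comp_apply, h0, map_zero]
      obtain ⟨y, rfl⟩ := (hex (i + 1) (by lia) x).1 hfx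
      refine ⟨LinearMap.applyₗ' (Module.End R ω) y, LinearMap.ext ?_⟩
      rintro ⟨_, φ, rfl⟩
      exact (hx φ).symm
  refine (key j 0 (by lia)).of_linearEquiv ?_
  have hsurj : LinearMap.range (dualMap ω (f 0)) = ⊤ := LinearMap.range_eq_top.2 fun g =>
    (happ 0 (by lia)).exists_extend g (by rw [LinearMap.ker_eq_bot.2 (hinj (by lia))]; exact bot_le)
  refine (LinearMap.ringLmapEquivSelf R (Module.End R ω) ω).symm ≪≫ₗ ?_ ≪≫ₗ
    (LinearEquiv.ofTop _ hsurj).symm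
  exact LinearEquiv.ofBijective (dualMap ω e.toLinearMap)
    ⟨fun a b hab => LinearMap.ext fun x => by
      simpa [dualMap] using LinearMap.congr_fun hab (e.symm x),
    fun g => ⟨g ∘ₗ e.symm.toLinearMap, LinearMap.ext fun x => by simp [dualMap]⟩⟩

end FaithfulDimension

/-! ### Independence of the presentation -/

section Transpose

variable {R : Type u} [Ring R]

lemma exists_lift_of_exact {P A B C : Type*} [AddCommGroup P] [Module R P] [Module.Projective R P]
    [AddCommGroup A] [Module R A] [AddCommGroup B] [Module R B] [AddCommGroup C] [Module R C]
    {f : A →ₗ[R] B} {p : B →ₗ[R] C} (hfp : Function.Exact f p) (h : P →ₗ[R] B)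
    (hh : ∀ x, p (h x) = 0) : ∃ s : P →ₗ[R] A, ∀ x, f (s x) = h x := by
  obtain ⟨s, hs⟩ := Module.projective_lifting_property f.rangeRestrict
    (h.codRestrict (LinearMap.range f) fun x => (hfp _).1 (hh x)) f.surjective_rangeRestrict
  exact ⟨s, fun x => congrArg Subtype.val (LinearMap.congr_fun hs x)⟩

variable {ω : Type u} [AddCommGroup ω] [Module R ω]

/-- The vanishing of `Ext^i` of the transpose does not depend on the presentation, provided that
`Ext^i` of `ω` itself vanishes. Comparison maps between the two presentations induce maps between
the transposes, whose composite differs from the identity by a map that factors through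
`Hom_R(P₁, ω)`. -/
theorem ExtVanish.transpose_of_presentation {P₁ P₀ Q₁ Q₀ M : Type u}
    [AddCommGroup P₁] [Module R P₁] [AddCommGroup P₀] [Module R P₀]
    [AddCommGroup Q₁] [Module R Q₁] [AddCommGroup Q₀] [Module R Q₀]
    [AddCommGroup M] [Module R M]
    [Module.Finite R P₁] [Module.Projective R P₁] [Module.Projective R P₀]
    [Module.Projective R Q₁] [Module.Projective R Q₀]
    {f : P₁ →ₗ[R] P₀} {p : P₀ →ₗ[R] M} (hfp : Function.Exact f p) (hp : Function.Surjective p)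
    {g : Q₁ →ₗ[R] Q₀} {q : Q₀ →ₗ[R] M} (hgq : Function.Exact g q) (hq : Function.Surjective q)
    {Z : Type u} [AddCommGroup Z] [Module (Module.End R ω) Z] {i : ℕ}
    (hω : ExtVanish (Module.End R ω) ω Z i)
    (h : ExtVanish (Module.End R ω) (Transpose ω g) Z i) :
    ExtVanish (Module.End R ω) (Transpose ω f) Z i := by
  obtain ⟨a₀, ha₀⟩ := Module.projective_lifting_property q p hq
  obtain ⟨b₀, hb₀⟩ := Module.projective_lifting_property p q hp
  replace ha₀ : ∀ x, q (a₀ x) = p x := LinearMap.congr_fun ha₀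
  replace hb₀ : ∀ x, p (b₀ x) = q x := LinearMap.congr_fun hb₀
  obtain ⟨a₁, ha₁⟩ := exists_lift_of_exact hgq (a₀ ∘ₗ f) fun x => by
    simp [ha₀, hfp.apply_apply_eq_zero]
  obtain ⟨b₁, hb₁⟩ := exists_lift_of_exact hfp (b₀ ∘ₗ g) fun x => by
    simp [hb₀, hgq.apply_apply_eq_zero]
  obtain ⟨s, hs⟩ := exists_lift_of_exact hfp (b₀ ∘ₗ a₀ - LinearMap.id) fun x => by
    simp [ha₀, hb₀]
  -- In degree one, the composite `b₁ ∘ a₁` is homotopic to the identity only up to a map `e` with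
  -- `f ∘ e = 0`, since the presentation is not continued to a resolution.
  let e : P₁ →ₗ[R] P₁ := b₁ ∘ₗ a₁ - LinearMap.id - s ∘ₗ f
  have he : f ∘ₗ e = 0 := LinearMap.ext fun x => by simp [e, ha₁, hb₁, hs]
  let α : Transpose ω f →ₗ[Module.End R ω] Transpose ω g :=
    Submodule.mapQ _ _ (dualMap ω b₁) <| by
      rintro _ ⟨φ, rfl⟩
      exact ⟨φ ∘ₗ b₀, LinearMap.ext fun x => congrArg φ (hb₁ x).symm⟩
  let β : Transpose ω g →ₗ[Module.End R ω] Transpose ω f :=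
    Submodule.mapQ _ _ (dualMap ω a₁) <| by
      rintro _ ⟨φ, rfl⟩
      exact ⟨φ ∘ₗ a₀, LinearMap.ext fun x => congrArg φ (ha₁ x).symm⟩
  let γ : Transpose ω f →ₗ[Module.End R ω] (P₁ →ₗ[R] ω) :=
    Submodule.liftQ _ (dualMap ω e) <| by
      rintro _ ⟨φ, rfl⟩
      exact LinearMap.ext fun x => (congrArg φ (LinearMap.congr_fun he x)).trans (map_zero φ)
  refine .of_sum_comp_eq_id
    (fun b : Bool => bif b then ModuleCat.of _ (Transpose ω g) else ModuleCat.of _ (P₁ →ₗ[R] ω))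
    (Bool.rec γ α) (Bool.rec (-Submodule.mkQ _) β) ?_ (Bool.rec ?_ h)
  · intro x
    obtain ⟨φ, rfl⟩ := Submodule.mkQ_surjective _ x
    rw [Fintype.sum_bool]
    change Submodule.mkQ _ (φ ∘ₗ b₁ ∘ₗ a₁) + -Submodule.mkQ _ (φ ∘ₗ e) = Submodule.mkQ _ φ
    rw [← sub_eq_add_neg, ← map_sub, ← sub_eq_zero, ← map_sub]
    refine (Submodule.Quotient.mk_eq_zero _).2 ⟨φ ∘ₗ s, LinearMap.ext fun x => ?_⟩
    change φ (s (f x)) = φ (b₁ (a₁ x)) - φ (b₁ (a₁ x) - x - s (f x)) - φ x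
    simp only [map_sub]
    abel
  · exact extVanish_dual_of_projective hω

end Transpose

/-! ### Transposes relative to a coinduced module -/

section Coinduced

variable {R S : Type u} [Ring R] [Ring S] [Module R S]
  {W V : Type u} [AddCommGroup W] [Module S W] [AddCommGroup V] [Module R V]
  [Module R W] [IsScalarTower R S W] {ε : W →ₗ[R] V}

lemma IsCoinduced.ext (hε : IsCoinduced R S ε) {X : Type u} [AddCommGroup X] [Module S X]
    [Module R X] [IsScalarTower R S X] {h h' : X →ₗ[S] W} (hh : ∀ x, ε (h x) = ε (h' x)) :
    h = h' :=
  (hε X (ε ∘ₗ h'.restrictScalars R)).unique (LinearMap.ext hh) rfl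

/-- The ring homomorphism `End_R(V) → End_S(W)` induced by coinduction; it sends `t` to the unique
`S`-linear map `t'` such that `ε ∘ t' = t ∘ ε`. -/
noncomputable def IsCoinduced.endHom (hε : IsCoinduced R S ε) :
    Module.End R V →+* Module.End S W :=
  have h (t : Module.End R V) (w : W) : ε ((hε W (t ∘ₗ ε)).choose w) = t (ε w) :=
    LinearMap.congr_fun (hε W (t ∘ₗ ε)).choose_spec.1 w
  { toFun := fun t => (hε W (t ∘ₗ ε)).choose
    map_one' := hε.ext fun w => by rw [h]; rfl
    map_mul' := fun s t => hε.ext fun w => by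
      rw [h, Module.End.mul_apply, Module.End.mul_apply, h, h]
    map_zero' := hε.ext fun w => by rw [h]; simp
    map_add' := fun s t => hε.ext fun w => by simp [h] }

lemma IsCoinduced.apply_endHom (hε : IsCoinduced R S ε) (t : Module.End R V) (w : W) :
    ε (hε.endHom t w) = t (ε w) :=
  LinearMap.congr_fun (hε W (t ∘ₗ ε)).choose_spec.1 w

/-- Let `W` be coinduced from `V` and, over `R`, a member of `add V`. Composition with `ε`
identifies the transpose of `f` relative to `W` with the transpose relative to `V` of the same map
over `R`. Moreover `End_S(W) ≅ Hom_R(W, V)` is projective over `End_R(V)`, and since `W` is reflexive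
with respect to `V`, the `End_S(W)`-module `W` is coinduced from the `End_R(V)`-module `V`. So the two
Ext groups are compared by `extVanish_change_of_rings`. -/
theorem IsCoinduced.extVanish_transpose_iff (hε : IsCoinduced R S ε) (hW : MemAdd (R := R) V W)
    {P₁ P₀ : Type u} [AddCommGroup P₁] [Module S P₁] [Module R P₁] [IsScalarTower R S P₁]
    [AddCommGroup P₀] [Module S P₀] [Module R P₀] [IsScalarTower R S P₀] (f : P₁ →ₗ[S] P₀)
    (i : ℕ) :
    ExtVanish (Module.End S W) (Transpose W f) W (i + 1) ↔
      ExtVanish (Module.End R V) (Transpose V (f.restrictScalars R)) V (i + 1) := by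
  let : Module (Module.End R V) W := Module.compHom W hε.endHom
  have smul_def (t : Module.End R V) (w : W) : t • w = hε.endHom t w := rfl
  have : SMulCommClass S (Module.End R V) W := ⟨fun s t w => by
    rw [smul_def, smul_def, map_smul]⟩
  have : IsScalarTower (Module.End R V) (Module.End S W) W := ⟨fun _ _ _ => rfl⟩
  have (P : Type u) [AddCommGroup P] [Module S P] :
    IsScalarTower (Module.End R V) (Module.End S W) (P →ₗ[S] W) := ⟨fun _ _ _ => rfl⟩
  have : IsScalarTower (Module.End R V) (Module.End S W) (Module.End S W) := ⟨fun _ _ _ => rfl⟩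
  let εT : W →ₗ[Module.End R V] V :=
    { toFun := ε, map_add' := map_add ε, map_smul' := hε.apply_endHom }
  have bij (P : Type u) [AddCommGroup P] [Module S P] [Module R P] [IsScalarTower R S P] :
      Function.Bijective fun h : P →ₗ[S] W => ε ∘ₗ h.restrictScalars R :=
    ⟨fun h h' hh => hε.ext (LinearMap.congr_fun hh), fun g => (hε P g).exists⟩
  let E (P : Type u) [AddCommGroup P] [Module S P] [Module R P] [IsScalarTower R S P] :
      (P →ₗ[S] W) ≃ₗ[Module.End R V] (P →ₗ[R] V) :=
    LinearEquiv.ofBijective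
      { toFun := fun h => ε ∘ₗ h.restrictScalars R
        map_add' := fun h h' => LinearMap.ext fun x => map_add ε _ _
        map_smul' := fun t h => LinearMap.ext fun x => hε.apply_endHom t (h x) } (bij P)
  have hE (P : Type u) [AddCommGroup P] [Module S P] [Module R P] [IsScalarTower R S P]
      (h : P →ₗ[S] W) (x : P) : E P h x = ε (h x) := rfl
  have : Module.Projective (Module.End R V) (Module.End S W) :=
    have := hW.projective_dual
    .of_equiv (E W).symm
  have sep {w w' : W} (h : ∀ t : Module.End S W, ε (t w) = ε (t w')) : w = w' :=
    hW.eq_of_forall_apply_eq fun φ => by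
      obtain ⟨t, rfl⟩ := (E W).surjective φ
      exact h t
  have hεT : IsCoinduced (Module.End R V) (Module.End S W) εT := by
    intro X _ _ _ _ g
    -- The value at `x` of the map to be constructed represents the functional `t ↦ g (t • x)`.
    have hw (x : X) : ∃ w : W, ∀ t : Module.End S W, g (t • x) = ε (t w) := by
      obtain ⟨w, hw⟩ := hW.exists_eq_eval
        (g ∘ₗ (LinearMap.toSpanSingleton (Module.End S W) X x).restrictScalars (Module.End R V) ∘ₗ
          (E W).symm.toLinearMap)
      refine ⟨w, fun t => ?_⟩
      rw [← hE, ← hw]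
      simp
    choose w hw using hw
    refine ⟨{ toFun := w, map_add' := fun x y => ?_, map_smul' := fun t x => ?_ }, ?_, ?_⟩
    · exact sep fun t => by rw [map_add, map_add, ← hw, ← hw, ← hw, smul_add, map_add]
    · exact sep fun t' => by
        rw [← hw, smul_smul, hw]; rfl
    · exact LinearMap.ext fun x => (hw x 1).symm.trans (by rw [one_smul])
    · rintro h rfl
      refine LinearMap.ext fun x => sep fun t => ?_
      exact (congrArg ε (map_smul h t x).symm).trans (hw x t)
  rw [extVanish_change_of_rings hεT]
  let e : Transpose W f ≃ₗ[Module.End R V] Transpose V (f.restrictScalars R) :=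
    (Submodule.Quotient.restrictScalarsEquiv (Module.End R V) _).symm ≪≫ₗ
      Submodule.Quotient.equiv _ _ (E P₁) (by
        ext φ
        constructor
        · rintro ⟨_, ⟨h, rfl⟩, rfl⟩
          exact ⟨E P₀ h, rfl⟩
        · rintro ⟨g, rfl⟩
          obtain ⟨h, rfl⟩ := (E P₀).surjective g
          exact ⟨_, ⟨h, rfl⟩, rfl⟩)
  exact ⟨.of_linearEquiv e.symm, .of_linearEquiv e⟩

end Coinduced

/-! ### The tensor product over a noncommutative ring -/

section ExtendScalars

variable {R S : Type u} [Ring R] [Ring S] (l : R →+* S)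
  {M : Type u} [AddCommGroup M] [Module R M]

/-- The pure tensor `s ⊗ m` in `S ⊗_R M`. -/
def ExtendScalars.tmul (s : S) (m : M) : ExtendScalars l M := (tensorRel l M).mkQ (s ⊗ₜ m)

namespace ExtendScalars

lemma tmul_add (s : S) (m m' : M) : tmul l s (m + m') = tmul l s m + tmul l s m' := by
  rw [tmul, TensorProduct.tmul_add, map_add]; rfl

lemma add_tmul (s s' : S) (m : M) : tmul l (s + s') m = tmul l s m + tmul l s' m := by
  rw [tmul, TensorProduct.add_tmul, map_add]; rfl

lemma smul_tmul (s s' : S) (m : M) : s • tmul l s' m = tmul l (s * s') m := rfl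

lemma mul_tmul (s : S) (r : R) (m : M) : tmul l (s * l r) m = tmul l s (r • m) :=
  (Submodule.Quotient.eq _).2 (Submodule.subset_span ⟨s, r, m, rfl⟩)

lemma sum_tmul {ι : Type*} (t : Finset ι) (s : ι → S) (m : M) :
    tmul l (∑ i ∈ t, s i) m = ∑ i ∈ t, tmul l (s i) m :=
  map_sum (AddMonoidHom.mk' (fun s => tmul l s m) fun _ _ => add_tmul l _ _ m) _ _

lemma tmul_sum {ι : Type*} (t : Finset ι) (s : S) (m : ι → M) :
    tmul l s (∑ i ∈ t, m i) = ∑ i ∈ t, tmul l s (m i) :=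
  map_sum (AddMonoidHom.mk' (tmul l s) (tmul_add l s)) _ _

variable {l}

lemma induction {p : ExtendScalars l M → Prop} (tmul : ∀ s m, p (tmul l s m))
    (add : ∀ x y, p x → p y → p (x + y)) (x : ExtendScalars l M) : p x := by
  obtain ⟨z, rfl⟩ := Submodule.mkQ_surjective _ x
  induction z with
  | zero => simpa [ExtendScalars.tmul] using tmul 0 0
  | tmul s m => exact tmul s m
  | add a b ha hb => rw [map_add]; exact add _ _ ha hb

/-- The additive map `S ⊗_R M → N` induced by a biadditive map balanced over `R`. -/
def lift {N : Type*} [AddCommGroup N] (b : S →+ M →+ N)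
    (hb : ∀ s r m, b (s * l r) m = b s (r • m)) : ExtendScalars l M →+ N :=
  QuotientAddGroup.lift (tensorRel l M).toAddSubgroup
    (TensorProduct.liftAddHom b fun k s m => by
      rw [map_zsmul, map_zsmul, AddMonoidHom.zsmul_apply]) <| by
      intro z hz
      suffices ∀ s : S, TensorProduct.liftAddHom b (fun k s m => by
          rw [map_zsmul, map_zsmul, AddMonoidHom.zsmul_apply]) (s • z) = 0 by
        simpa using this 1
      induction hz using Submodule.span_induction with
      | mem z hz =>
        obtain ⟨s', r, m, rfl⟩ := hz
        intro s
        simp [smul_sub, TensorProduct.smul_tmul', ← hb, mul_assoc]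
      | zero => simp
      | add x y _ _ hx hy => intro s; rw [smul_add, map_add, hx, hy, add_zero]
      | smul s' x _ hx => intro s; rw [smul_smul, hx]

end ExtendScalars

end ExtendScalars

/-! ### Restriction of scalars along a centrally projective Frobenius extension -/

section Restriction

variable {R S : Type u} [Ring R] [Ring S] {l : R →+* S}

/-- A Frobenius extension has a Frobenius system: an `R`-bimodule map `lam : S → R`, the value at
`1` of the bimodule isomorphism `S ≅ Hom_R(S, R)`, and dual bases `x`, `y` with respect to it. The
first basis property is the dual basis of the projective module `S`, and the second follows from it
because the isomorphism is injective. -/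
lemma IsFrobeniusExtension.exists_frobeniusSystem (h : IsFrobeniusExtension l) :
    ∃ (lam : S →+ R) (k : ℕ) (x y : Fin k → S),
      (∀ r s, lam (l r * s) = r * lam s) ∧ (∀ s r, lam (s * l r) = lam s * r) ∧
      (∀ s, ∑ i, l (lam (s * y i)) * x i = s) ∧ ∀ s, ∑ i, y i * l (lam (x i * s)) = s := by
  let : Module R S := Module.compHom S l
  obtain ⟨hfin, hproj, e, he, he'⟩ := h
  have hs (s t : S) : e s t = e 1 (t * s) := by rw [← he, mul_one]
  obtain ⟨k, a, b, hab⟩ := memAdd_iff.1 (memAdd_of_finite_of_projective (R := R) (X := S))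
  have hx (s : S) : ∑ i, l (e 1 (s * e.symm (a i))) * b i 1 = s := by
    conv_rhs => rw [← hab s]
    refine Finset.sum_congr rfl fun i _ => ?_
    rw [← hs, e.apply_symm_apply]
    exact (map_smul (b i) (a i s) (1 : R)).symm.trans (by rw [smul_eq_mul, mul_one])
  have hl (r : R) (s : S) : e 1 (l r * s) = r * e 1 s := map_smul (e 1) r s
  have hr (s : S) (r : R) : e 1 (s * l r) = e 1 s * r := by rw [← hs, ← he' 1 r s, one_mul]
  refine ⟨(e 1).toAddMonoidHom, k, fun i => b i 1, fun i => e.symm (a i), hl, hr, hx, fun s => ?_⟩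
  refine e.injective (LinearMap.ext fun t => ?_)
  rw [hs, hs s, Finset.mul_sum, map_sum]
  conv_rhs => rw [← hx t, Finset.sum_mul, map_sum]
  refine Finset.sum_congr rfl fun i _ => ?_
  rw [← mul_assoc, hr, mul_assoc (l _), hl]
  rfl

variable (l) in
/-- For a Frobenius extension, induced modules are coinduced. With a Frobenius system
`(lam, x, y)`, the counit is `s ⊗ m ↦ lam s • m`, and the `S`-linear map corresponding to
`g : X → M` is `z ↦ ∑ i, y i ⊗ g (x i • z)`. -/
lemma exists_isCoinduced (h : IsFrobeniusExtension l) (M : Type u) [AddCommGroup M] [Module R M] :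
    letI : Module R S := Module.compHom S l
    letI : Module R (ExtendScalars l M) := Module.compHom _ l
    haveI : IsScalarTower R S (ExtendScalars l M) := ⟨fun r s x => mul_smul (l r) s x⟩
    ∃ ε : ExtendScalars l M →ₗ[R] M, IsCoinduced R S ε := by
  obtain ⟨lam, k, x, y, hl, hr, hx, hy⟩ := h.exists_frobeniusSystem
  let : Module R S := Module.compHom S l
  let : Module R (ExtendScalars l M) := Module.compHom _ l
  have : IsScalarTower R S (ExtendScalars l M) := ⟨fun r s x => mul_smul (l r) s x⟩
  let ε₀ : ExtendScalars l M →+ M :=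
    ExtendScalars.lift ((smulAddHom R M).comp lam) fun s r m => by simp [hr, mul_smul]
  have hε₀ (s : S) (m : M) : ε₀ (ExtendScalars.tmul l s m) = lam s • m := rfl
  let ε : ExtendScalars l M →ₗ[R] M :=
    { ε₀ with
      map_smul' := fun r z => by
        change ε₀ (l r • z) = r • ε₀ z
        induction z using ExtendScalars.induction with
        | tmul s m => rw [ExtendScalars.smul_tmul, hε₀, hε₀, hl, mul_smul]
        | add a b ha hb => rw [smul_add, map_add, ha, hb, map_add, smul_add] }
  refine ⟨ε, fun X _ _ _ _ g => ?_⟩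
  have hX (r : R) (z : X) : l r • z = r • z := by
    rw [← one_smul S z, ← smul_assoc r (1 : S) z]
    change l r • _ = (l r * 1) • z
    rw [mul_one, one_smul]
  refine ⟨{ toFun := fun z => ∑ i, ExtendScalars.tmul l (y i) (g (x i • z))
            map_add' := fun z z' => by
              simp only [smul_add, map_add, ExtendScalars.tmul_add, Finset.sum_add_distrib]
            map_smul' := fun s z => ?_ }, ?_, ?_⟩
  · -- The Casimir identity `∑ y i ⊗ x i * s = ∑ s * y i ⊗ x i`.
    have h1 (i : Fin k) : g (x i • s • z) = ∑ j, lam (x i * s * y j) • g (x j • z) := by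
      conv_lhs => rw [smul_smul, ← hx (x i * s), Finset.sum_smul, map_sum]
      exact Finset.sum_congr rfl fun j _ => by rw [mul_smul, hX, map_smul]
    simp only [h1, ExtendScalars.tmul_sum, ← ExtendScalars.mul_tmul, RingHom.id_apply,
      Finset.smul_sum, ExtendScalars.smul_tmul]
    rw [Finset.sum_comm]
    refine Finset.sum_congr rfl fun j _ => ?_
    rw [← ExtendScalars.sum_tmul]
    simp only [mul_assoc, hy]
  · refine LinearMap.ext fun z => ?_
    change ε₀ (∑ i, ExtendScalars.tmul l (y i) (g (x i • z))) = g z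
    rw [map_sum]
    conv_rhs => rw [← one_smul S z, ← hx 1, Finset.sum_smul, map_sum]
    exact Finset.sum_congr rfl fun i _ => by rw [hε₀, one_mul, mul_smul, hX, map_smul g]
  · rintro h rfl
    refine LinearMap.ext fun z => ?_
    change h z = ∑ i, ExtendScalars.tmul l (y i) (ε₀ (h (x i • z)))
    simp only [map_smul]
    induction h z using ExtendScalars.induction with
    | tmul s m =>
      simp only [ExtendScalars.smul_tmul, hε₀, ← ExtendScalars.mul_tmul]
      rw [← ExtendScalars.sum_tmul, hy]
    | add a b ha hb =>
      simp only [smul_add, map_add, ExtendScalars.tmul_add, Finset.sum_add_distrib]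
      rw [← ha, ← hb]

/-- Tensoring the splitting `S ⊕ ? = R ^ k` of `R`-bimodules with `M`. -/
lemma memAdd_extendScalars (h : IsCentrallyProjective l) (M : Type u) [AddCommGroup M]
    [Module R M] :
    letI : Module R (ExtendScalars l M) := Module.compHom _ l
    MemAdd (R := R) M (ExtendScalars l M) := by
  let : Module R (ExtendScalars l M) := Module.compHom _ l
  obtain ⟨k, ι, π, hι, hι', hπ, hπ', hπι⟩ := h
  have h1 (j : Fin k) (r : R) : π (Pi.single j r) = π (Pi.single j 1) * l r := by
    rw [← hπ']
    congr 1
    ext i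
    by_cases hij : i = j
    · subst hij; simp
    · simp [hij]
  have h2 (j : Fin k) (r : R) : π (Pi.single j r) = l r * π (Pi.single j 1) := by
    rw [← hπ]
    congr 1
    ext i
    by_cases hij : i = j
    · subst hij; simp
    · simp [hij]
  let a₀ (j : Fin k) : ExtendScalars l M →+ M :=
    ExtendScalars.lift ((smulAddHom R M).comp ((Pi.evalAddMonoidHom _ j).comp ι))
      fun s r m => by simp [hι', mul_smul]
  have ha₀ (j : Fin k) (s : S) (m : M) : a₀ j (ExtendScalars.tmul l s m) = ι s j • m := rfl
  refine memAdd_iff.2 ⟨k, fun j =>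
    { a₀ j with
      map_smul' := fun r z => by
        change a₀ j (l r • z) = r • a₀ j z
        induction z using ExtendScalars.induction with
        | tmul s m => rw [ExtendScalars.smul_tmul, ha₀, ha₀, hι, mul_smul]
        | add a b ha hb => rw [smul_add, map_add, ha, hb, map_add, smul_add] }, fun j =>
    { toFun := ExtendScalars.tmul l (π (Pi.single j 1))
      map_add' := ExtendScalars.tmul_add l _
      map_smul' := fun r m => by
        rw [← ExtendScalars.mul_tmul, ← h1, h2]; rfl }, fun z => ?_⟩
  change ∑ j, ExtendScalars.tmul l (π (Pi.single j 1)) (a₀ j z) = z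
  induction z using ExtendScalars.induction with
  | tmul s m =>
    simp only [ha₀, ← ExtendScalars.mul_tmul, ← h1]
    rw [← ExtendScalars.sum_tmul, ← map_sum, Finset.univ_sum_single, hπι]
  | add a b ha hb =>
    simp only [map_add, ExtendScalars.tmul_add, Finset.sum_add_distrib]
    rw [ha, hb]

lemma exists_finite_projective_presentation [IsNoetherianRing S] (M : Type u) [AddCommGroup M]
    [Module S M] [Module.Finite S M] :
    ∃ (P₁ P₀ : ModuleCat.{u} S) (f : P₁ →ₗ[S] P₀) (p : P₀ →ₗ[S] M),
      Module.Finite S P₁ ∧ Module.Projective S P₁ ∧ Module.Finite S P₀ ∧ Module.Projective S P₀ ∧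
      Function.Exact f p ∧ Function.Surjective p := by
  obtain ⟨m, p, hp⟩ := Module.Finite.exists_fin' S M
  obtain ⟨k, q, hq⟩ := Module.Finite.exists_fin' S p.ker
  refine ⟨.of S (Fin k → S), .of S (Fin m → S), p.ker.subtype ∘ₗ q, p, inferInstance,
    inferInstance, inferInstance, inferInstance, fun x => ⟨fun hx => ?_, ?_⟩, hp⟩
  · obtain ⟨z, hz⟩ := hq ⟨x, hx⟩
    exact ⟨z, congrArg Subtype.val hz⟩
  · rintro ⟨z, rfl⟩
    exact (q z).2

/-- Relative torsionfreeness of an `S`-module is detected on the underlying `R`-module. From `S` to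
`R`, an `S`-presentation restricts to an `R`-presentation; from `R` to `S`, the given
`R`-presentation need not come from `S`, and has to be exchanged for one that does. -/
theorem torsionfreeClass_restrictScalars_iff [IsNoetherianRing S]
    (hFrob : IsFrobeniusExtension l) (hCentral : IsCentrallyProjective l) {n : ℕ}
    {ω : Type u} [AddCommGroup ω] [Module R ω] (hfadim : FaithfulDimGE R ω (n + 2))
    (M : ModuleCat.{u} S) :
    torsionfreeClass S (ExtendScalars l ω) n M ↔
      torsionfreeClass R ω n ((ModuleCat.restrictScalars l).obj M) := by
  let : Module R S := Module.compHom S l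
  let : Module R (ExtendScalars l ω) := Module.compHom _ l
  have : IsScalarTower R S (ExtendScalars l ω) := ⟨fun r s x => mul_smul (l r) s x⟩
  have : IsScalarTower R S S := ⟨fun r s x => mul_smul (l r) s x⟩
  obtain ⟨ε, hε⟩ := exists_isCoinduced l hFrob ω
  have hW := memAdd_extendScalars hCentral ω
  have : Module.Finite R S := hFrob.1
  have : Module.Projective R S := hFrob.2.1
  let (P : ModuleCat.{u} S) : Module R P := Module.compHom P l
  have (P : ModuleCat.{u} S) : IsScalarTower R S P := ⟨fun r s x => mul_smul (l r) s x⟩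
  have hfin (P : ModuleCat.{u} S) (hP : Module.Finite S P) : Module.Finite R P := .trans S P
  have hproj (P : ModuleCat.{u} S) (hP : Module.Projective S P) : Module.Projective R P := by
    obtain ⟨F, _, _, _, _, _, _, q, hq⟩ := exists_projective_surjection R (B := S) P
    obtain ⟨s, hs⟩ := Module.projective_lifting_property q LinearMap.id hq
    exact .of_split (s.restrictScalars R) (q.restrictScalars R)
      (LinearMap.ext fun x => LinearMap.congr_fun hs x)
  constructor
  · rintro ⟨hM, P₁, P₀, f, p, h₁, h₁', h₀, h₀', hfp, hp, h⟩
    refine ⟨hfin M hM, .of R P₁, .of R P₀, f.restrictScalars R, p.restrictScalars R, hfin _ h₁,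
      hproj _ h₁', hfin _ h₀, hproj _ h₀', hfp, hp, fun i hi hin => ?_⟩
    obtain ⟨j, rfl⟩ := Nat.exists_eq_add_of_le' hi
    exact (hε.extVanish_transpose_iff hW f j).1 (h _ hi hin)
  · rintro ⟨hM, Q₁, Q₀, g, q, h₁, h₁', h₀, h₀', hgq, hq, h⟩
    have hM' : Module.Finite R M := hM
    have hMS : Module.Finite S M := .of_restrictScalars_finite R S M
    obtain ⟨P₁, P₀, f, p, h₁, h₁', h₀, h₀', hfp, hp⟩ :=
      exists_finite_projective_presentation (S := S) M
    refine ⟨hMS, P₁, P₀, f, p, h₁, h₁', h₀, h₀', hfp, hp, fun i hi hin => ?_⟩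
    obtain ⟨j, rfl⟩ := Nat.exists_eq_add_of_le' hi
    have := hfin P₁ h₁
    have := hproj P₁ h₁'
    have := hproj P₀ h₀'
    refine (hε.extVanish_transpose_iff hW f j).2 ?_
    exact ExtVanish.transpose_of_presentation (p := p.restrictScalars R) hfp hp hgq hq
      (hfadim.extVanish hin) (h _ hi hin)

end Restriction
end RelTorsionfree

theorem proposition4p5 {R S : Type u} [Ring R] [Ring S]
    [IsNoetherianRing R] [IsNoetherianRing Rᵐᵒᵖ] [IsNoetherianRing S] [IsNoetherianRing Sᵐᵒᵖ]
    (l : R →+* S)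
    (hFrob : RelTorsionfree.IsFrobeniusExtension l)
    (hCentral : RelTorsionfree.IsCentrallyProjective l)
    (n : ℕ) (hn : 1 ≤ n)
    (ω : Type u) [AddCommGroup ω] [Module R ω] [Module.Finite R ω]
    (hfadim : RelTorsionfree.FaithfulDimGE R ω (n + 2))
    (hExt : ∀ i : ℕ, 1 ≤ i → i ≤ n →
      Subsingleton (Abelian.Ext.{u} (ModuleCat.of R ω) (ModuleCat.of R ω) i))
    (hclosed : (RelTorsionfree.torsionfreeClass R ω n).IsClosedUnderExtensions) :
    (RelTorsionfree.torsionfreeClass S (RelTorsionfree.ExtendScalars l ω) n).IsClosedUnderExtensions := by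
  have hiff := RelTorsionfree.torsionfreeClass_restrictScalars_iff hFrob hCentral hfadim
  refine ⟨fun {E} hE h₁ h₃ => (hiff _).2 ?_⟩
  have hE' : (E.map (ModuleCat.restrictScalars l)).ShortExact :=
    ModuleCat.shortComplex_shortExact _
      ((ShortComplex.ShortExact.moduleCat_exact_iff_function_exact E).1 hE.exact)
      hE.moduleCat_injective_f hE.moduleCat_surjective_g
  exact hclosed.prop_X₂_of_shortExact hE' ((hiff _).1 h₁) ((hiff _).1 h₃)
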